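/- Let $n=p+q$ with $q>1$ and $\gcd(n,p)=1$, and let $g,r$ be non-negative integers with $N:=qr-ng>0$, $\gcd(p,r-g)=1$ and $\gcd(n,r)=1$. Write $e(\alpha)=e^{2\pi i\alpha}$ and $R=p^pq^q/n^n$, and consider the trinomial equation $$f(X,Y)=Y^n-X^gY^p+X^r=0 .$$ For $t\in\{0,\dots,n-1\}$ let $Y_t$ be its root given near $X=\infty$, as a function of $X^{1/n}$, by $$Y_0(X)=\frac{e(\frac1{2n})}{n}\sum_{k\ge 0}\frac{\Gamma(\frac{1+pk}{n})}{\Gamma(\frac{1-qk}{n}+1)\,k!}\,e\!\left(-\tfrac{qk}{2n}\right)\,(X^{1/n})^{r-Nk},\qquad Y_t(X)=Y_0(e(t)X),$$ where $1/\Gamma$ is $0$ at the poles of $\Gamma$, and where passing from $X$ to $e(t)X$ means replacing $X^{1/n}$ by $e(t/n)X^{1/n}$. For integers $j,\ell$ (in particular for $0\le j\le n-1$, $0\le \ell\le p-1$) put $\bar\ell=p(j+1)+\ell$ and let $$X_\ell^{(j)}=\omega_{\bar\ell}=R^{1/N}e(\bar\ell/N)$$ be the corresponding branch point, at which the functions $Y_t$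 are evaluated with $X^{1/n}=R^{1/(nN)}e(\bar\ell/(nN))$. Then the series defining $Y_t$ converges absolutely at $X=X_\ell^{(j)}$ for every $t\in\{0,\dots,n-1\}$, and its value there satisfies $f(X_\ell^{(j)},Y_t(X_\ell^{(j)}))=0$. For $t\ne t'$ in $\{0,\dots,n-1\}$ the roots $Y_t(X_\ell^{(j)})$ and $Y_{t'}(X_\ell^{(j)})$ coincide if and only if, possibly after exchanging $t$ and $t'$, $$rt'\equiv rt+1 \pmod n\quad\text{and}\quad prt\equiv pj+\ell \pmod n .$$ Given the first congruence, the second one is equivalent to $\bar\ell\equiv prt' \pmod n$; that is, $Y_t(\omega_{\bar\ell})=Y_{t'}(\omega_{\bar\ell})$ with $\bar\ell\equiv prt'\pmod n$. -/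

import Mathlib

noncomputable section

namespace Trinomial

/-- The notation `e(α) = exp(2πiα)`. -/
def e (α : ℝ) : ℂ := Complex.exp (2 * Real.pi * Complex.I * α)

/-- The constant `R = p^p q^q / n^n`. -/
def R (n p q : ℕ) : ℝ := ((p : ℝ) ^ p * (q : ℝ) ^ q) / (n : ℝ) ^ n

/-- The trinomial `f(X, Y) = Y^n - X^g Y^p + X^r`. -/
def f (n p g r : ℕ) (X Y : ℂ) : ℂ := Y ^ n - X ^ g * Y ^ p + X ^ r

/-- The `k`-th term of the Puiseux series at `X = ∞`, as a function of `ξ = X^{1/n}`: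
`Γ((1+pk)/n) / (Γ((1-qk)/n + 1) k!) * (-1)^{-qk/n} * ξ^{r-Nk}` with `(-1)^{-qk/n} = e(-qk/(2n))`.
(`Real.Gamma` is `0` at its poles and `x / 0 = 0`, so that `1/Γ` vanishes there, as it should.) -/
def seriesTerm (n p q r N : ℕ) (ξ : ℂ) (k : ℕ) : ℂ :=
  ((Real.Gamma ((1 + (p : ℝ) * k) / n) /
      (Real.Gamma ((1 - (q : ℝ) * k) / n + 1) * (k.factorial : ℝ)) : ℝ) : ℂ) *
    e (-((q : ℝ) * k) / (2 * n)) * ξ ^ ((r : ℤ) - (N : ℤ) * (k : ℤ))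

/-- The root `Y_0`, as a function of `ξ = X^{1/n}`, with `(-1)^{1/n} = e(1/(2n))`. -/
def Y₀ (n p q r N : ℕ) (ξ : ℂ) : ℂ :=
  e (1 / (2 * (n : ℝ))) / (n : ℂ) * ∑' k : ℕ, seriesTerm n p q r N ξ k

/-- The root `Y_t(X) = Y_0(e(t) X)`: the argument of `X` increases by `2πt`, that is
`ξ = X^{1/n}` is replaced by `e(t/n) ξ`. -/
def Y (n p q r N : ℕ) (t : ℕ) (ξ : ℂ) : ℂ :=
  Y₀ n p q r N (e ((t : ℝ) / n) * ξ)

/-- The branch point `ω_m = R^{1/N} e(m/N)`. -/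
def ω (n p q N : ℕ) (m : ℤ) : ℂ :=
  ((R n p q ^ (1 / (N : ℝ)) : ℝ) : ℂ) * e ((m : ℝ) / N)

/-- The value of `X^{1/n}` at `X = ω_m` for the argument `2πm/N` of `ω_m`. -/
def ωRoot (n p q N : ℕ) (m : ℤ) : ℂ :=
  ((R n p q ^ (1 / ((n : ℝ) * N)) : ℝ) : ℂ) * e ((m : ℝ) / ((n : ℝ) * N))

/-- `ωRoot` is indeed an `n`-th root of the branch point. -/
theorem ωRoot_pow (n p q N : ℕ) (hn : n ≠ 0) (m : ℤ) :
    ωRoot n p q N m ^ n = ω n p q N m := by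
  have hn' : (n : ℝ) ≠ 0 := Nat.cast_ne_zero.mpr hn
  have hR : 0 ≤ R n p q := by unfold R; positivity
  have h1 : (R n p q ^ (1 / ((n : ℝ) * N))) ^ n = R n p q ^ (1 / (N : ℝ)) := by
    rw [← Real.rpow_natCast, ← Real.rpow_mul hR]
    congr 1
    rw [one_div, one_div, mul_inv]
    field_simp
  have h2 : e ((m : ℝ) / ((n : ℝ) * N)) ^ n = e ((m : ℝ) / N) := by
    unfold e
    rw [← Complex.exp_nat_mul]
    congr 1
    have : (n : ℂ) ≠ 0 := Nat.cast_ne_zero.mpr hn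
    push_cast
    rw [div_eq_mul_inv, div_eq_mul_inv, mul_inv]
    field_simp
  unfold ωRoot ω
  rw [mul_pow, h2, ← Complex.ofReal_pow, h1]

end Trinomial

end

/-!
Substituting `Y = e(1/(2n)) ξ^r φ` with `ξ = X^{1/n}` turns the trinomial equation into
`φ^n = 1 + w φ^p`, where `w = e(-q/(2n)) ξ^{-N}`. The series in question is the branch `φ = branch`
with `φ(0) = 1`, and at the points `ω_m` of the statement `‖w‖ = ρ = radius = R^{-1/n}`.

*The equation.* The coefficients of `branch` are the values at `1/n` of the Hagen polynomials
`A_k(x) = x/(x+tk) * binom(x+tk, k)`, `t = p/n` (`Gamma_quotient_eq_hagen`). They satisfy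
`A_{k+1}(x+1) - A_{k+1}(x) = A_k(x+t)`, which gives the Rothe–Hagen convolution identity
`eval_hagen_add`, hence the trinomial equation at the level of formal power series. Cauchy products
transfer it to every `w` at which the series converges absolutely (`branch_pow`).

*Convergence for `‖w‖ ≤ ρ`.* On the circle `‖w‖ = ρ` the ratio of the `(k+n)`-th term to the
`k`-th one, if the latter is not zero, is `1 - (3n/2)/k + O(1/k²)` in absolute value, and Kummer's
test applies (`summable_hagen_mul_radius_pow`).

*Sectors.* By the weighted inequality of the arithmetic and geometric means,
`1 + x^n ≥ ρ x^p` for `x > 0`, with equality only at `x^n = p/q`. So `φ(w)^n` is never a negative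
real number for `‖w‖ < ρ`, and by connectedness `φ(w)` stays in the sector `|arg| < π/n`. In the
limit, `|arg φ(w)| ≤ π/n` for `‖w‖ = ρ`, and the edges are reached at most at
`w = ρ e(± q/(2n))` (`eq_radius_mul_e_of_arg`).

*Coincidences.* Two roots `e(s/n) φ(w)` and `e(s'/n) φ(w')` with `s ≢ s'` lie in different closed
sectors, so they can agree only on a common edge; this determines `s' - s` modulo `n`, `w` and `w'`
(`branch_eq_e_mul_branch`). Conversely the agreement at `w = ρ e(q/(2n))`, `w' = ρ e(-q/(2n))` does
take place (`branch_critical`): otherwise the `n` roots would be pairwise distinct, while the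
trinomial of degree `n` has a double root there. What remains are congruences modulo `n`.
-/

namespace Trinomial

open Filter Topology

/-! ### The Rothe–Hagen identity -/

open Polynomial in
/-- The Hagen polynomial `A_k(x) = x/(x+tk) * binom(x+tk, k)`, with the factor `x + tk` cancelled:
`A_k(x) = x/k! * ∏_{0 < i < k} (x + tk - i)` for `k > 0`, and `A_0 = 1`. -/
noncomputable def hagen {K : Type*} [Field K] (t : K) : ℕ → K[X]
  | 0 => 1
  | k + 1 => C (((k + 1).factorial : K)⁻¹) * X *
      ∏ i ∈ Finset.range k, (X + C (t * (k + 1) - (i + 1)))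

section
variable {K : Type*} [Field K]

theorem hagen_zero (t : K) : hagen t 0 = 1 := rfl

theorem eval_hagen_succ (t : K) (k : ℕ) (x : K) :
    (hagen t (k + 1)).eval x = ((k + 1).factorial : K)⁻¹ * x *
      ∏ i ∈ Finset.range k, (x + (t * (k + 1) - (i + 1))) := by
  simp [hagen, Polynomial.eval_prod]

theorem eval_zero_hagen_succ (t : K) (k : ℕ) : (hagen t (k + 1)).eval 0 = 0 := by
  simp [eval_hagen_succ]

/-- If `B = 1 + z B^t` is the generating function with `B^x = ∑ A_k(x) z^k`, this is the relation
`B^{x+1} - B^x = z B^{x+t}`. -/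
theorem eval_hagen_add_one [CharZero K] (t : K) (k : ℕ) (x : K) :
    (hagen t (k + 1)).eval (x + 1) = (hagen t (k + 1)).eval x + (hagen t k).eval (x + t) := by
  rcases k with _ | m
  · simp [eval_hagen_succ, hagen_zero]
  · rw [eval_hagen_succ, eval_hagen_succ, eval_hagen_succ, Finset.prod_range_succ',
      Finset.prod_range_succ]
    have h1 : ∀ i : ℕ, x + 1 + (t * ((m + 1 : ℕ) + 1) - ((i + 1 : ℕ) + 1)) =
        x + (t * ((m + 1 : ℕ) + 1) - ((i : K) + 1)) := by intro i; push_cast; ring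
    have h2 : ∀ i : ℕ, x + t + (t * ((m : K) + 1) - ((i : K) + 1)) =
        x + (t * ((m + 1 : ℕ) + 1) - ((i : K) + 1)) := by intro i; push_cast; ring
    simp only [h1, h2]
    have h3 : ((m + 1 + 1).factorial : K) = (m + 2) * (m + 1).factorial := by
      rw [Nat.factorial_succ (m + 1)]; push_cast; ring
    have h4 : ((m + 1).factorial : K) ≠ 0 := Nat.cast_ne_zero.mpr (Nat.factorial_ne_zero _)
    have h5 : (m : K) + 2 ≠ 0 := by exact_mod_cast (Nat.succ_ne_zero (m + 1))
    rw [h3]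
    field_simp
    push_cast
    ring

/-- The Rothe–Hagen identity. By induction the difference of the two sides, a polynomial in `x`, has
period `1`, so it is constant; and it vanishes at `x = 0`. -/
theorem eval_hagen_add [CharZero K] (t : K) (m : ℕ) (x y : K) :
    (hagen t m).eval (x + y) =
      ∑ kl ∈ Finset.HasAntidiagonal.antidiagonal m,
        (hagen t kl.1).eval x * (hagen t kl.2).eval y := by
  induction m generalizing x with
  | zero => simp [hagen_zero]
  | succ m ih =>
    let D : Polynomial K := (hagen t (m + 1)).comp (Polynomial.X + Polynomial.C y) -
      ∑ kl ∈ Finset.HasAntidiagonal.antidiagonal (m + 1),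
        hagen t kl.1 * Polynomial.C ((hagen t kl.2).eval y)
    have hD : ∀ x, D.eval x = (hagen t (m + 1)).eval (x + y) -
        ∑ kl ∈ Finset.HasAntidiagonal.antidiagonal (m + 1),
          (hagen t kl.1).eval x * (hagen t kl.2).eval y := by
      intro x
      simp [D, Polynomial.eval_finsetSum]
    have h0 : D.eval 0 = 0 := by
      rw [hD, Finset.Nat.antidiagonal_succ]
      simp [eval_zero_hagen_succ, hagen_zero]
    have hstep : ∀ x, D.eval (x + 1) = D.eval x := by
      intro x
      rw [hD, hD, Finset.Nat.antidiagonal_succ, add_right_comm x 1 y, eval_hagen_add_one]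
      simp only [Finset.sum_cons, Finset.sum_map, Function.Embedding.prodMap,
        Function.Embedding.coeFn_mk, Prod.map, Function.Embedding.refl_apply,
        Nat.succ_eq_add_one, eval_hagen_add_one, add_mul, Finset.sum_add_distrib,
        hagen_zero, Polynomial.eval_one]
      rw [add_right_comm x y t, ih (x + t)]
      ring
    have hnat : ∀ k : ℕ, D.eval (k : K) = 0 := by
      intro k
      induction k with
      | zero => simpa using h0
      | succ k ihk => rw [Nat.cast_succ, hstep, ihk]
    have hz : D = 0 := by
      refine Polynomial.eq_zero_of_infinite_isRoot D ?_
      exact (Set.infinite_range_of_injective (Nat.cast_injective (R := K))).mono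
        (by rintro _ ⟨k, rfl⟩; exact hnat k)
    have := hD x
    rw [hz, Polynomial.eval_zero] at this
    exact (sub_eq_zero.mp this.symm)

/-- The formal power series `∑ A_k(x) z^k`, which plays the role of `B^x` for `B = 1 + z B^t`. -/
noncomputable def hagenSeries (t x : K) : PowerSeries K :=
  PowerSeries.mk fun k => (hagen t k).eval x

theorem coeff_hagenSeries (t x : K) (k : ℕ) :
    PowerSeries.coeff k (hagenSeries t x) = (hagen t k).eval x := PowerSeries.coeff_mk _ _

theorem hagenSeries_add [CharZero K] (t x y : K) :
    hagenSeries t (x + y) = hagenSeries t x * hagenSeries t y := by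
  ext m
  simp only [PowerSeries.coeff_mul, coeff_hagenSeries, eval_hagen_add]

theorem hagenSeries_zero (t : K) : hagenSeries t 0 = 1 := by
  ext m
  rcases m with _ | m
  · simp [coeff_hagenSeries, hagen_zero]
  · simp [coeff_hagenSeries, eval_zero_hagen_succ, PowerSeries.coeff_one]

theorem hagenSeries_pow [CharZero K] (t x : K) (j : ℕ) :
    hagenSeries t x ^ j = hagenSeries t (j * x) := by
  induction j with
  | zero => simp [hagenSeries_zero]
  | succ j ih => rw [pow_succ, ih, ← hagenSeries_add]; congr 1; push_cast; ring

theorem hagenSeries_one [CharZero K] (t : K) :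
    hagenSeries t 1 = 1 + PowerSeries.X * hagenSeries t t := by
  ext m
  rcases m with _ | m
  · simp [coeff_hagenSeries, hagen_zero]
  -- the difference equation at `x = 0`, where `A_{m+1}` vanishes
  · have := eval_hagen_add_one t m 0
    rw [zero_add, zero_add, eval_zero_hagen_succ, zero_add] at this
    simp [coeff_hagenSeries, this, PowerSeries.coeff_succ_X_mul, PowerSeries.coeff_one]
end

/-! ### The branch at the origin of the trinomial -/

theorem summable_and_tsum_mul {F G : PowerSeries ℂ} {w : ℂ}
    (hF : Summable fun k => ‖PowerSeries.coeff k F * w ^ k‖)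
    (hG : Summable fun k => ‖PowerSeries.coeff k G * w ^ k‖) :
    (Summable fun k => ‖PowerSeries.coeff k (F * G) * w ^ k‖) ∧
    ∑' k, PowerSeries.coeff k (F * G) * w ^ k =
      (∑' k, PowerSeries.coeff k F * w ^ k) * ∑' k, PowerSeries.coeff k G * w ^ k := by
  have h : ∀ k, PowerSeries.coeff k (F * G) * w ^ k = ∑ ij ∈ Finset.HasAntidiagonal.antidiagonal k,
      (PowerSeries.coeff ij.1 F * w ^ ij.1) * (PowerSeries.coeff ij.2 G * w ^ ij.2) := by
    intro k
    rw [PowerSeries.coeff_mul, Finset.sum_mul]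
    refine Finset.sum_congr rfl fun ij hij => ?_
    rw [← Finset.HasAntidiagonal.mem_antidiagonal.mp hij, pow_add]; ring
  rw [funext h]
  have h1 := summable_norm_sum_mul_antidiagonal_of_summable_norm hF hG
  have h2 := tsum_mul_tsum_eq_tsum_sum_antidiagonal_of_summable_norm hF hG
  refine ⟨?_, h2.symm⟩
  simpa only [h] using h1

theorem summable_and_tsum_pow {F : PowerSeries ℂ} {w : ℂ}
    (hF : Summable fun k => ‖PowerSeries.coeff k F * w ^ k‖) (j : ℕ) :
    (Summable fun k => ‖PowerSeries.coeff k (F ^ j) * w ^ k‖) ∧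
    ∑' k, PowerSeries.coeff k (F ^ j) * w ^ k = (∑' k, PowerSeries.coeff k F * w ^ k) ^ j := by
  induction j with
  | zero =>
    have h0 : ∀ k, k ≠ 0 → PowerSeries.coeff k (F ^ 0) * w ^ k = 0 := by
      intro k hk
      simp [PowerSeries.coeff_one, hk]
    refine ⟨summable_of_ne_finset_zero (s := {0}) fun k hk => ?_, ?_⟩
    · rw [h0 k (by simpa using hk), norm_zero]
    · rw [tsum_eq_single 0 h0]; simp
  | succ j ih =>
    have := summable_and_tsum_mul ih.1 hF
    rw [pow_succ, pow_succ, ← ih.2]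
    exact this

/-- The branch `φ` of `φ^n = 1 + w φ^p` with `φ(0) = 1`, defined by its power series at `0`. -/
noncomputable def branch (n p : ℕ) (w : ℂ) : ℂ :=
  ∑' k, (hagen ((p : ℂ) / n) k).eval (1 / (n : ℂ)) * w ^ k

theorem branch_zero (n p : ℕ) : branch n p 0 = 1 := by
  unfold branch
  rw [tsum_eq_single 0]
  · simp [hagen_zero]
  · intro k hk; simp [hk]

/-- The trinomial equation, at every point of absolute convergence: in formal power series,
`F(1/n)^n = F(1) = 1 + z F(p/n) = 1 + z F(1/n)^p`. -/
theorem branch_pow {n p : ℕ} (hn : n ≠ 0) {w : ℂ}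
    (hw : Summable fun k => ‖(hagen ((p : ℂ) / n) k).eval (1 / (n : ℂ)) * w ^ k‖) :
    branch n p w ^ n = 1 + w * branch n p w ^ p := by
  have hn' : (n : ℂ) ≠ 0 := Nat.cast_ne_zero.mpr hn
  set F := hagenSeries ((p : ℂ) / n) (1 / (n : ℂ)) with hF
  have hs : Summable fun k => ‖PowerSeries.coeff k F * w ^ k‖ := by
    simpa only [hF, coeff_hagenSeries] using hw
  have hb : branch n p w = ∑' k, PowerSeries.coeff k F * w ^ k := by
    simp only [hF, coeff_hagenSeries, branch]
  have hFn : F ^ n = 1 + PowerSeries.X * F ^ p := by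
    rw [hF, hagenSeries_pow, hagenSeries_pow, mul_one_div_cancel hn', mul_one_div,
      hagenSeries_one]
  obtain ⟨h1, h2⟩ := summable_and_tsum_pow hs n
  obtain ⟨h3, h4⟩ := summable_and_tsum_pow hs p
  rw [hb, ← h2, ← h4, h1.of_norm.tsum_eq_zero_add, hFn, ← tsum_mul_left]
  congr 1
  · simp
  · refine tsum_congr fun k => ?_
    simp [PowerSeries.coeff_succ_X_mul, PowerSeries.coeff_one, pow_succ]
    ring

/-! ### Coefficients as quotients of Gamma values -/

/-- This holds at the poles as well, since there `Real.Gamma` is `0` and both sides vanish. -/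
theorem inv_Gamma_eq_prod_mul (s : ℝ) (m : ℕ) :
    (Real.Gamma s)⁻¹ = (∏ i ∈ Finset.range m, (s + i)) * (Real.Gamma (s + m))⁻¹ := by
  induction m with
  | zero => simp
  | succ m ih =>
    have h : (Real.Gamma (s + m))⁻¹ = (s + m) * (Real.Gamma (s + m + 1))⁻¹ := by
      rcases eq_or_ne (s + m) 0 with h0 | h0
      · simp [h0]
      · rw [Real.Gamma_add_one h0, mul_inv, mul_inv_cancel_left₀ h0]
    rw [ih, h, Finset.prod_range_succ, Nat.cast_succ, ← add_assoc]
    ring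

/-- The two arguments of `Γ` differ by the integer `k - 1`, so that the quotient is a
finite product. -/
theorem Gamma_quotient_eq_hagen {n p q : ℕ} (hn : n = p + q) (hn0 : n ≠ 0) (k : ℕ) :
    Real.Gamma ((1 + (p : ℝ) * k) / n) /
      (Real.Gamma ((1 - (q : ℝ) * k) / n + 1) * (k.factorial : ℝ)) =
    n * (hagen ((p : ℝ) / n) k).eval (1 / (n : ℝ)) := by
  have hn' : (n : ℝ) ≠ 0 := Nat.cast_ne_zero.mpr hn0
  have hnq : (n : ℝ) = p + q := by rw [hn]; push_cast; rfl
  rcases k with _ | m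
  · have h1 : Real.Gamma (1 / (n : ℝ)) ≠ 0 := (Real.Gamma_pos_of_pos (by positivity)).ne'
    simp only [Nat.cast_zero, mul_zero, add_zero, sub_zero, Nat.factorial_zero, Nat.cast_one,
      mul_one, hagen_zero, Polynomial.eval_one]
    rw [Real.Gamma_add_one (by positivity)]
    field_simp
  · have ha : 0 < Real.Gamma ((1 + (p : ℝ) * (m + 1 : ℕ)) / n) :=
      Real.Gamma_pos_of_pos (by positivity)
    have hs : (1 - (q : ℝ) * (m + 1 : ℕ)) / n + 1 + m = (1 + (p : ℝ) * (m + 1 : ℕ)) / n := by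
      field_simp
      rw [hnq]; push_cast; ring
    rw [div_mul_eq_div_div, div_eq_mul_inv (Real.Gamma _) (Real.Gamma _),
      inv_Gamma_eq_prod_mul _ m, hs, mul_comm, mul_comm _ (Real.Gamma _)⁻¹, eval_hagen_succ,
      ← Finset.prod_range_reflect]
    have : ∀ i ∈ Finset.range m, (1 - (q : ℝ) * (m + 1 : ℕ)) / n + 1 + ((m - 1 - i : ℕ) : ℝ) =
        1 / (n : ℝ) + ((p : ℝ) / n * (m + 1) - (i + 1)) := by
      intro i hi
      have hi' := Finset.mem_range.mp hi
      rw [Nat.sub_sub, Nat.cast_sub (by omega)]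
      field_simp
      rw [hnq]; push_cast; ring
    rw [Finset.prod_congr rfl this]
    field_simp

/-! ### Absolute convergence on the closed disc -/

/-- The radius of convergence `ρ = R^{-1/n}` of `branch n p`. -/
noncomputable def radius (n p q : ℕ) : ℝ := R n p q ^ (-(1 / (n : ℝ)))

theorem R_pos {n p q : ℕ} (hn : 0 < n) (hp : 0 < p) (hq : 0 < q) : 0 < R n p q := by
  unfold R; positivity

theorem radius_pos {n p q : ℕ} (hn : 0 < n) (hp : 0 < p) (hq : 0 < q) : 0 < radius n p q :=
  Real.rpow_pos_of_pos (R_pos hn hp hq) _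

theorem radius_pow {n p q : ℕ} (hn : 0 < n) (hp : 0 < p) (hq : 0 < q) :
    radius n p q ^ n = (n : ℝ) ^ n / ((p : ℝ) ^ p * (q : ℝ) ^ q) := by
  have hn' : (n : ℝ) ≠ 0 := Nat.cast_ne_zero.mpr hn.ne'
  rw [radius, ← Real.rpow_natCast, ← Real.rpow_mul (R_pos hn hp hq).le, neg_mul,
    one_div_mul_cancel hn', Real.rpow_neg_one, R, inv_div]

theorem hasDerivAt_prod_one_add_mul {ι : Type*} (s : Finset ι) (a : ι → ℝ) :
    HasDerivAt (fun x : ℝ => ∏ i ∈ s, (1 + a i * x)) (∑ i ∈ s, a i) 0 := by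
  classical
  induction s using Finset.induction_on with
  | empty => simpa using hasDerivAt_const (0 : ℝ) (1 : ℝ)
  | insert i s hi ih =>
    have h1 : HasDerivAt (fun x : ℝ => 1 + a i * x) (a i) 0 := by
      simpa using ((hasDerivAt_id (0 : ℝ)).const_mul (a i)).const_add 1
    have := h1.fun_mul ih
    simpa [Finset.prod_insert hi, Finset.sum_insert hi] using this

theorem eventually_lt_of_hasDerivAt {f g : ℝ → ℝ} {f' g' a : ℝ} (hf : HasDerivAt f f' a)
    (hg : HasDerivAt g g' a) (h : f a = g a) (h' : f' < g') : ∀ᶠ x in 𝓝[>] a, f x < g x := by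
  have hd := (hg.sub hf).hasDerivWithinAt (s := Set.Ioi a)
  rw [hasDerivWithinAt_iff_tendsto_slope' (by simp)] at hd
  filter_upwards [hd.eventually (lt_mem_nhds (sub_pos.mpr h')), self_mem_nhdsWithin] with x hx hxa
  rw [slope_def_field, Pi.sub_apply, Pi.sub_apply, h, sub_self, sub_zero] at hx
  have := (div_pos_iff_of_pos_right (sub_pos.mpr hxa)).mp hx
  linarith

/-- Kummer's test with step `n`: `u (k + n)` is at most the difference of consecutive values of
`W M = ∑_{i < n} (M + i) u (M + i)`. -/
theorem summable_of_kummer {u : ℕ → ℝ} (hu : ∀ k, 0 ≤ u k) {n K : ℕ}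
    (h : ∀ k ≥ K, ((k : ℝ) + n + 1) * u (k + n) ≤ k * u k) : Summable u := by
  rw [← summable_nat_add_iff (K + n)]
  let W : ℕ → ℝ := fun M => ∑ i ∈ Finset.range n, ((M + i : ℕ) : ℝ) * u (M + i)
  have hW0 : ∀ M, 0 ≤ W M := fun M => Finset.sum_nonneg fun i _ => mul_nonneg (by positivity) (hu _)
  have hW : ∀ M, W M - W (M + 1) = (M : ℝ) * u M - ((M + n : ℕ) : ℝ) * u (M + n) := by
    intro M
    have h1 := Finset.sum_range_succ (fun i => ((M + i : ℕ) : ℝ) * u (M + i)) n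
    have h2 := Finset.sum_range_succ' (fun i => ((M + i : ℕ) : ℝ) * u (M + i)) n
    simp only [W]
    simp only [add_assoc, add_comm 1, add_zero] at h1 h2 ⊢
    linarith
  refine summable_of_sum_range_le (c := W K) (fun k => hu _) fun m => ?_
  have : ∑ i ∈ Finset.range m, u (i + (K + n)) ≤ W K - W (K + m) := by
    induction m with
    | zero => simp
    | succ m ih =>
      rw [Finset.sum_range_succ]
      have h1 := h (K + m) (by omega)
      have h2 := hW (K + m)
      rw [show m + (K + n) = K + m + n by ring, show K + (m + 1) = K + m + 1 by ring]
      push_cast at h1 h2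
      linarith
  linarith [hW0 (K + m)]

/-- The bound on the ratio of the `(k+n)`-th to the `k`-th term that Kummer's test requires. After
division by `k^{n+1}` both sides are polynomials in `1/k` with value `1` at `0`; their derivatives
there are `n(n-2)/2 + n + 1` on the left and the larger `n(n+1)/2` on the right, as `n > 2`. -/
theorem eventually_ratio_bound {n p q : ℕ} (hn : n = p + q) (hp : 0 < p) (hq : 1 < q) :
    ∀ᶠ k : ℕ in atTop, ((k : ℝ) + n + 1) * ((∏ i ∈ Finset.range p, ((k : ℝ) + (1 + i * n) / p)) *
      ∏ i ∈ Finset.range q, ((k : ℝ) + (i * n - 1) / q)) ≤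
      k * ∏ i ∈ Finset.range n, ((k : ℝ) + (1 + i)) := by
  have hp' : (p : ℝ) ≠ 0 := Nat.cast_ne_zero.mpr hp.ne'
  have hq' : (q : ℝ) ≠ 0 := Nat.cast_ne_zero.mpr (by omega)
  have hnq : (n : ℝ) = p + q := by rw [hn]; push_cast; rfl
  have gauss : ∀ m : ℕ, ∑ i ∈ Finset.range m, (i : ℝ) = m * (m - 1) / 2 := by
    intro m
    induction m with
    | zero => simp
    | succ m ih => rw [Finset.sum_range_succ, ih]; push_cast; ring
  have hlin : HasDerivAt (fun x : ℝ => 1 + (n + 1 : ℝ) * x) (n + 1) 0 := by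
    simpa using ((hasDerivAt_id (0 : ℝ)).const_mul (n + 1 : ℝ)).const_add 1
  have hL := hlin.fun_mul ((hasDerivAt_prod_one_add_mul (Finset.range p)
    (fun i => (1 + i * n : ℝ) / p)).fun_mul (hasDerivAt_prod_one_add_mul (Finset.range q)
    (fun i => (i * n - 1 : ℝ) / q)))
  have hR := hasDerivAt_prod_one_add_mul (Finset.range n) (fun i => (1 + i : ℝ))
  have hlt := eventually_lt_of_hasDerivAt hL hR (by simp) (by
    simp only [mul_zero, add_zero, Finset.prod_const_one, mul_one, one_mul]
    simp only [← Finset.sum_div, Finset.sum_add_distrib, Finset.sum_sub_distrib,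
      ← Finset.sum_mul, gauss, Finset.sum_const, Finset.card_range, nsmul_eq_mul, mul_one]
    have h3 : (1 : ℝ) < q := by exact_mod_cast hq
    have h4 : (1 : ℝ) ≤ p := by exact_mod_cast hp
    have e1 : ((p : ℝ) + p * (p - 1) / 2 * n) / p = 1 + (p - 1) / 2 * n := by field_simp
    have e2 : ((q : ℝ) * (q - 1) / 2 * n - q) / q = (q - 1) / 2 * n - 1 := by field_simp
    rw [e1, e2, hnq]
    nlinarith)
  have hx : Tendsto (fun k : ℕ => ((k : ℝ))⁻¹) atTop (𝓝[>] 0) :=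
    tendsto_inv_atTop_nhdsGT_zero.comp tendsto_natCast_atTop_atTop
  filter_upwards [hx.eventually hlt, eventually_gt_atTop 0] with k hk hk0
  have hk' : (0 : ℝ) < k := by exact_mod_cast hk0
  have key : ∀ (m : ℕ) (a : ℕ → ℝ), ∏ i ∈ Finset.range m, ((k : ℝ) + a i) =
      (k : ℝ) ^ m * ∏ i ∈ Finset.range m, (1 + a i * (k : ℝ)⁻¹) := by
    intro m a
    rw [← Finset.card_range m, ← Finset.prod_const, Finset.card_range, ← Finset.prod_mul_distrib]
    refine Finset.prod_congr rfl fun i _ => ?_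
    field_simp
  rw [key, key, key]
  have h1 : (k : ℝ) + n + 1 = k * (1 + (n + 1) * (k : ℝ)⁻¹) := by field_simp; ring
  have h2 : (k : ℝ) ^ n = k ^ p * k ^ q := by rw [hn, pow_add]
  rw [h1, h2]
  have h3 := mul_le_mul_of_nonneg_left hk.le (show (0 : ℝ) ≤ k * (k ^ p * k ^ q) by positivity)
  calc _ = _ := by ring
    _ ≤ _ := h3
    _ = _ := by ring

/-- The series of `branch` converges absolutely on the boundary of its disc of convergence. -/
theorem summable_hagen_mul_radius_pow {n p q : ℕ} (hn : n = p + q) (hp : 0 < p) (hq : 1 < q) :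
    Summable fun k => |(hagen ((p : ℝ) / n) k).eval (1 / (n : ℝ))| * radius n p q ^ k := by
  have hp' : (0 : ℝ) < p := Nat.cast_pos.mpr hp
  have hq' : (0 : ℝ) < q := Nat.cast_pos.mpr (by omega)
  have hnq : (n : ℝ) = p + q := by rw [hn]; push_cast; rfl
  have hn0 : 0 < n := by omega
  have hn' : (0 : ℝ) < n := Nat.cast_pos.mpr hn0
  have hr := radius_pos hn0 hp (by omega : 0 < q)
  obtain ⟨K, hK⟩ := eventually_atTop.mp (eventually_ratio_bound hn hp hq)
  refine summable_of_kummer (n := n) (K := K + 1)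
    (fun k => mul_nonneg (abs_nonneg _) (pow_nonneg hr.le _)) fun k hk => ?_
  have hk0 : 1 ≤ k := by omega
  have hk1 : (1 : ℝ) ≤ k := by exact_mod_cast hk0
  have hbd := hK k (by omega)
  have hrec : |(hagen ((p : ℝ) / n) (k + n)).eval (1 / (n : ℝ))| * radius n p q ^ (k + n) *
      ∏ i ∈ Finset.range n, ((k : ℝ) + (1 + i)) =
      |(hagen ((p : ℝ) / n) k).eval (1 / (n : ℝ))| * radius n p q ^ k *
      ((∏ i ∈ Finset.range p, ((k : ℝ) + (1 + i * n) / p)) *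
      ∏ i ∈ Finset.range q, ((k : ℝ) + (i * n - 1) / q)) := by
    have hP : Real.Gamma ((1 + (p : ℝ) * (k + n : ℕ)) / n) =
        (∏ i ∈ Finset.range p, ((1 + (p : ℝ) * k) / n + i)) *
          Real.Gamma ((1 + (p : ℝ) * k) / n) := by
      have h1 := inv_Gamma_eq_prod_mul ((1 + (p : ℝ) * k) / n) p
      have h2 : (1 + (p : ℝ) * k) / n + p = (1 + (p : ℝ) * (k + n : ℕ)) / n := by
        field_simp; push_cast; ring
      rw [h2] at h1
      have h3 : 0 < Real.Gamma ((1 + (p : ℝ) * k) / n) := Real.Gamma_pos_of_pos (by positivity)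
      have h4 : 0 < Real.Gamma ((1 + (p : ℝ) * (k + n : ℕ)) / n) :=
        Real.Gamma_pos_of_pos (by positivity)
      generalize ∏ i ∈ Finset.range p, ((1 + (p : ℝ) * k) / n + i) = P at h1 ⊢
      rw [← div_eq_mul_inv, inv_eq_one_div, div_eq_div_iff h3.ne' h4.ne'] at h1
      linarith
    -- stated with `1/Γ`, as the arguments may be poles of `Γ`
    have hQ : |(Real.Gamma ((1 - (q : ℝ) * (k + n : ℕ)) / n + 1))⁻¹| =
        (∏ i ∈ Finset.range q, (((q : ℝ) * k - 1) / n + i)) *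
          |(Real.Gamma ((1 - (q : ℝ) * k) / n + 1))⁻¹| := by
      have h2 : (1 - (q : ℝ) * (k + n : ℕ)) / n + 1 + q = (1 - (q : ℝ) * k) / n + 1 := by
        field_simp; push_cast; ring
      rw [inv_Gamma_eq_prod_mul _ q, h2, abs_mul, Finset.abs_prod, ← Finset.prod_range_reflect]
      congr 1
      refine Finset.prod_congr rfl fun i hi => ?_
      have hi' := Finset.mem_range.mp hi
      have h3 : (1 - (q : ℝ) * (k + n : ℕ)) / n + 1 + ((q - 1 - i : ℕ) : ℝ) =
          -(((q : ℝ) * k - 1) / n + i) := by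
        rw [Nat.sub_sub, Nat.cast_sub (by omega)]
        field_simp; push_cast; ring
      have h4 : (0 : ℝ) ≤ (q : ℝ) * k - 1 := by
        have : (1 : ℝ) < q := by exact_mod_cast hq
        nlinarith
      rw [h3, abs_neg, abs_of_nonneg (by positivity)]
    have hfac : ((k + n).factorial : ℝ) =
        k.factorial * ∏ i ∈ Finset.range n, ((k : ℝ) + (1 + i)) := by
      rw [← Nat.factorial_mul_ascFactorial, Nat.cast_mul, Nat.ascFactorial_eq_prod_range]
      push_cast
      congr 1
      exact Finset.prod_congr rfl fun i _ => by ring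
    have hA : ∀ m : ℕ, |(hagen ((p : ℝ) / n) m).eval (1 / (n : ℝ))| =
        |Real.Gamma ((1 + (p : ℝ) * m) / n)| * |(Real.Gamma ((1 - (q : ℝ) * m) / n + 1))⁻¹| /
          (m.factorial * n) := by
      intro m
      rw [← mul_div_cancel_left₀ ((hagen ((p : ℝ) / n) m).eval (1 / (n : ℝ))) hn'.ne',
        ← Gamma_quotient_eq_hagen hn hn0.ne', abs_div, abs_div, abs_mul, abs_inv,
        abs_of_pos hn', Nat.abs_cast]
      ring
    have hprodP : ∏ i ∈ Finset.range p, ((k : ℝ) + (1 + i * n) / p) =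
        ((n : ℝ) / p) ^ p * ∏ i ∈ Finset.range p, ((1 + (p : ℝ) * k) / n + i) := by
      rw [← Finset.card_range p, ← Finset.prod_const, Finset.card_range, ← Finset.prod_mul_distrib]
      refine Finset.prod_congr rfl fun i _ => ?_
      field_simp
      ring
    have hprodQ : ∏ i ∈ Finset.range q, ((k : ℝ) + (i * n - 1) / q) =
        ((n : ℝ) / q) ^ q * ∏ i ∈ Finset.range q, (((q : ℝ) * k - 1) / n + i) := by
      rw [← Finset.card_range q, ← Finset.prod_const, Finset.card_range, ← Finset.prod_mul_distrib]
      refine Finset.prod_congr rfl fun i _ => ?_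
      field_simp
      ring
    have hrad : radius n p q ^ n = ((n : ℝ) / p) ^ p * ((n : ℝ) / q) ^ q := by
      rw [radius_pow hn0 hp (by omega), div_pow, div_pow, div_mul_div_comm, ← pow_add, ← hn]
    have hprod0 : ∏ i ∈ Finset.range n, ((k : ℝ) + (1 + i)) ≠ 0 :=
      (Finset.prod_pos fun i _ => by positivity).ne'
    rw [hA, hA, hQ, hP, hfac, hprodP, hprodQ, pow_add, hrad, abs_mul,
      abs_of_nonneg (Finset.prod_nonneg fun i _ => by positivity)]
    field_simp
  have hprod : 0 < ∏ i ∈ Finset.range n, ((k : ℝ) + (1 + i)) :=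
    Finset.prod_pos fun i _ => by positivity
  refine le_of_mul_le_mul_right ?_ hprod
  calc _ = ((k : ℝ) + n + 1) * (|(hagen ((p : ℝ) / n) (k + n)).eval (1 / (n : ℝ))| *
        radius n p q ^ (k + n) * ∏ i ∈ Finset.range n, ((k : ℝ) + (1 + i))) := by ring
    _ = |(hagen ((p : ℝ) / n) k).eval (1 / (n : ℝ))| * radius n p q ^ k * (((k : ℝ) + n + 1) *
      ((∏ i ∈ Finset.range p, ((k : ℝ) + (1 + i * n) / p)) *
      ∏ i ∈ Finset.range q, ((k : ℝ) + (i * n - 1) / q))) := by rw [hrec]; ring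
    _ ≤ |(hagen ((p : ℝ) / n) k).eval (1 / (n : ℝ))| * radius n p q ^ k *
      (k * ∏ i ∈ Finset.range n, ((k : ℝ) + (1 + i))) := by gcongr
    _ = _ := by ring

/-! ### The branch on the closed disc -/

theorem eval_hagen_ofReal (n p k : ℕ) : (hagen ((p : ℂ) / n) k).eval (1 / (n : ℂ)) =
    (((hagen ((p : ℝ) / n) k).eval (1 / (n : ℝ)) : ℝ) : ℂ) := by
  rcases k with _ | k
  · simp [hagen_zero]
  · rw [eval_hagen_succ, eval_hagen_succ]; push_cast; rfl

theorem norm_branch_term_le {n p q : ℕ} {w : ℂ} (hw : ‖w‖ ≤ radius n p q) (k : ℕ) :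
    ‖(hagen ((p : ℂ) / n) k).eval (1 / (n : ℂ)) * w ^ k‖ ≤
      |(hagen ((p : ℝ) / n) k).eval (1 / (n : ℝ))| * radius n p q ^ k := by
  rw [eval_hagen_ofReal, norm_mul, Complex.norm_real, Real.norm_eq_abs, norm_pow]
  gcongr

section
variable {n p q : ℕ} (hn : n = p + q) (hp : 0 < p) (hq : 1 < q)
include hn hp hq

theorem summable_norm_branch_term {w : ℂ} (hw : ‖w‖ ≤ radius n p q) :
    Summable fun k => ‖(hagen ((p : ℂ) / n) k).eval (1 / (n : ℂ)) * w ^ k‖ :=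
  (summable_hagen_mul_radius_pow hn hp hq).of_nonneg_of_le (fun _ => norm_nonneg _)
    (norm_branch_term_le hw)

theorem continuousOn_branch :
    ContinuousOn (branch n p) (Metric.closedBall 0 (radius n p q)) :=
  continuousOn_tsum (fun k => by fun_prop) (summable_hagen_mul_radius_pow hn hp hq)
    fun k w hw => norm_branch_term_le (by simpa using hw) k

theorem branch_trinomial {w : ℂ} (hw : ‖w‖ ≤ radius n p q) :
    branch n p w ^ n = 1 + w * branch n p w ^ p :=
  branch_pow (by omega) (summable_norm_branch_term hn hp hq hw)

theorem branch_ne_zero {w : ℂ} (hw : ‖w‖ ≤ radius n p q) : branch n p w ≠ 0 := by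
  intro h
  have := branch_trinomial hn hp hq hw
  rw [h, zero_pow (by omega), zero_pow (by omega)] at this
  simp at this

/-- The equality case `x^n = p/q` of `ρ x^p ≤ 1 + x^n`. -/
theorem radius_mul_pow_eq {x : ℝ} (hx : 0 < x) (hs : x ^ n = p / q) :
    radius n p q * x ^ p = 1 + x ^ n := by
  have hp' : (0 : ℝ) < p := Nat.cast_pos.mpr hp
  have hq' : (0 : ℝ) < q := Nat.cast_pos.mpr (by omega)
  have hnq : (n : ℝ) = p + q := by rw [hn]; push_cast; rfl
  have hr := radius_pos (n := n) (by omega) hp (by omega : 0 < q)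
  refine (pow_left_inj₀ (by positivity) (by positivity) (by omega : n ≠ 0)).mp ?_
  rw [mul_pow, ← pow_mul, mul_comm p n, pow_mul, hs, radius_pow (by omega) hp (by omega)]
  have : 1 + (p : ℝ) / q = n / q := by rw [hnq]; field_simp; ring
  rw [this, div_pow, div_pow]
  have h2 : (q : ℝ) ^ n = q ^ p * q ^ q := by rw [hn, pow_add]
  rw [h2]
  field_simp

/-- The weighted inequality of the arithmetic and geometric means for `n/q` and `n x^n / p` with
weights `q/n` and `p/n`, in the form of strict concavity of the logarithm. -/
theorem radius_mul_pow_lt {x : ℝ} (hx : 0 < x) (hs : x ^ n ≠ p / q) :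
    radius n p q * x ^ p < 1 + x ^ n := by
  have hp' : (0 : ℝ) < p := Nat.cast_pos.mpr hp
  have hq' : (0 : ℝ) < q := Nat.cast_pos.mpr (by omega)
  have hnq : (n : ℝ) = p + q := by rw [hn]; push_cast; rfl
  have hn' : (0 : ℝ) < n := by rw [hnq]; positivity
  have hr := radius_pos (n := n) (by omega) hp (by omega : 0 < q)
  have hlog := strictConcaveOn_log_Ioi.2 (show (n : ℝ) / q ∈ Set.Ioi (0 : ℝ) from
      Set.mem_Ioi.mpr (by positivity))
    (show (n : ℝ) * x ^ n / p ∈ Set.Ioi (0 : ℝ) from Set.mem_Ioi.mpr (by positivity))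
    (by
      intro h
      apply hs
      field_simp at h ⊢
      linarith)
    (show (0 : ℝ) < q / n by positivity) (show (0 : ℝ) < p / n by positivity)
    (by rw [← add_div, hnq, add_comm, div_self (by positivity)])
  have h1 : (q / n : ℝ) • ((n : ℝ) / q) + (p / n : ℝ) • ((n : ℝ) * x ^ n / p) = 1 + x ^ n := by
    simp only [smul_eq_mul]
    field_simp
  rw [h1] at hlog
  rw [← Real.log_lt_log_iff (by positivity) (by positivity)]
  refine lt_of_eq_of_lt ?_ hlog
  have h2 : (n : ℝ) * Real.log (radius n p q) =
      n * Real.log n - p * Real.log p - q * Real.log q := by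
    rw [← Real.log_pow, radius_pow (by omega) hp (by omega), Real.log_div (by positivity)
      (by positivity), Real.log_mul (by positivity) (by positivity), Real.log_pow, Real.log_pow,
      Real.log_pow]
    ring
  rw [Real.log_mul hr.ne' (by positivity), Real.log_pow, smul_eq_mul, smul_eq_mul,
    Real.log_div (by positivity) (by positivity), Real.log_div (by positivity) (by positivity),
    Real.log_mul (by positivity) (by positivity), Real.log_pow]
  field_simp
  linear_combination h2 + Real.log n * hnq

/-- A value of the branch whose `n`-th power is a negative real number occurs only on the boundary
of the disc, and only with `n`-th power `-p/q`. -/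
theorem norm_eq_of_branch_pow_eq_neg {w : ℂ} (hw : ‖w‖ ≤ radius n p q)
    (h : branch n p w ^ n = -((‖branch n p w‖ : ℂ) ^ n)) :
    ‖w‖ = radius n p q ∧ ‖branch n p w‖ ^ n = p / q := by
  set x := ‖branch n p w‖ with hx
  have hx0 : 0 < x := norm_pos_iff.mpr (branch_ne_zero hn hp hq hw)
  have h1 : w * branch n p w ^ p = -((1 + x ^ n : ℝ) : ℂ) := by
    have := branch_trinomial hn hp hq hw
    rw [h] at this
    push_cast
    linear_combination -this
  have h2 : ‖w‖ * x ^ p = 1 + x ^ n := by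
    have := congrArg norm h1
    rwa [norm_mul, norm_pow, norm_neg, Complex.norm_real, Real.norm_eq_abs,
      abs_of_pos (by positivity)] at this
  have h3 : ‖w‖ * x ^ p ≤ radius n p q * x ^ p := by gcongr
  have hs : x ^ n = p / q := by
    by_contra hne
    linarith [radius_mul_pow_lt hn hp hq hx0 hne]
  refine ⟨mul_right_cancel₀ (pow_pos hx0 p).ne' ?_, hs⟩
  rw [h2, radius_mul_pow_eq hn hp hq hx0 hs]
end

/-! ### The sector containing the values of the branch -/

theorem pow_eq_neg_of_arg {n : ℕ} (hn : n ≠ 0) {u : ℂ} (h : |u.arg| = Real.pi / n) :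
    u ^ n = -((‖u‖ : ℂ) ^ n) := by
  have hn' : (n : ℂ) ≠ 0 := Nat.cast_ne_zero.mpr hn
  conv_lhs => rw [← Complex.norm_mul_exp_arg_mul_I u]
  rw [mul_pow, ← Complex.exp_nat_mul]
  rcases abs_eq (by positivity) |>.mp h with h | h
  · rw [h]; push_cast
    rw [show (n : ℂ) * (Real.pi / n * Complex.I) = Real.pi * Complex.I by field_simp,
      Complex.exp_pi_mul_I]
    ring
  · rw [h]; push_cast
    rw [show (n : ℂ) * (-(Real.pi / n) * Complex.I) = -(Real.pi * Complex.I) by field_simp,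
      Complex.exp_neg, Complex.exp_pi_mul_I]
    norm_num

theorem abs_arg_le_of_cos_mul_norm_le {u : ℂ} (hu : u ≠ 0) {θ : ℝ} (h0 : 0 ≤ θ)
    (h : Real.cos θ * ‖u‖ ≤ u.re) : |u.arg| ≤ θ := by
  by_contra! hlt
  have h1 := Real.cos_lt_cos_of_nonneg_of_le_pi h0 (Complex.abs_arg_le_pi u) hlt
  rw [Real.cos_abs, Complex.cos_arg hu, div_lt_iff₀ (norm_pos_iff.mpr hu)] at h1
  linarith

theorem abs_arg_eq_of_cos_mul_norm_eq {u : ℂ} (hu : u ≠ 0) {θ : ℝ} (h0 : 0 ≤ θ) (h1 : θ ≤ Real.pi)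
    (h : Real.cos θ * ‖u‖ = u.re) : |u.arg| = θ := by
  refine Real.injOn_cos ⟨abs_nonneg _, Complex.abs_arg_le_pi u⟩ ⟨h0, h1⟩ ?_
  rw [Real.cos_abs, Complex.cos_arg hu, div_eq_iff (norm_pos_iff.mpr hu).ne', h]

section
variable {n p q : ℕ} (hn : n = p + q) (hp : 0 < p) (hq : 1 < q)
include hn hp hq

theorem cos_mul_norm_branch_lt {w : ℂ} (hw : ‖w‖ < radius n p q) :
    Real.cos (Real.pi / n) * ‖branch n p w‖ < (branch n p w).re := by
  have hr := radius_pos (n := n) (by omega) hp (by omega : 0 < q)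
  have hn1 : (1 : ℝ) < n := by exact_mod_cast (by omega : 1 < n)
  have hpi0 : 0 < Real.pi / n := by positivity
  have hpi : Real.pi / n ≤ Real.pi := div_le_self Real.pi_pos.le hn1.le
  let h : ℂ → ℝ := fun w => (branch n p w).re - Real.cos (Real.pi / n) * ‖branch n p w‖
  have hc : ContinuousOn h (Metric.ball 0 (radius n p q)) := by
    have := (continuousOn_branch hn hp hq).mono Metric.ball_subset_closedBall
    exact (Complex.continuous_re.comp_continuousOn this).sub (continuousOn_const.mul this.norm)
  have hpre : IsPreconnected (Metric.ball (0 : ℂ) (radius n p q)) :=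
    (convex_ball _ _).isPreconnected
  have h0 : 0 < h 0 := by
    simp only [h, branch_zero, Complex.one_re, norm_one, mul_one, sub_pos]
    simpa using Real.cos_lt_cos_of_nonneg_of_le_pi le_rfl hpi hpi0
  -- on the edge of the sector `branch ^ n` would be a negative real number
  by_contra! hle
  have hle' : h w ≤ 0 := by simp only [h]; linarith
  obtain ⟨v, hv, hv0⟩ := hpre.intermediate_value (by simpa using hw) (by simpa using hr) hc
    ⟨hle', h0.le⟩
  have hvr : ‖v‖ < radius n p q := by simpa using hv
  have harg := abs_arg_eq_of_cos_mul_norm_eq (branch_ne_zero hn hp hq hvr.le) hpi0.le hpi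
    (by simp only [h] at hv0; linarith)
  exact hvr.ne (norm_eq_of_branch_pow_eq_neg hn hp hq hvr.le
    (pow_eq_neg_of_arg (by omega) harg)).1

theorem abs_arg_branch_le {w : ℂ} (hw : ‖w‖ ≤ radius n p q) :
    |(branch n p w).arg| ≤ Real.pi / n := by
  have hr := radius_pos (n := n) (by omega) hp (by omega : 0 < q)
  refine abs_arg_le_of_cos_mul_norm_le (branch_ne_zero hn hp hq hw) (by positivity) ?_
  have hc := continuousOn_branch hn hp hq
  rw [← closure_ball _ hr.ne'] at hc
  refine le_on_closure (s := Metric.ball (0 : ℂ) (radius n p q))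
    (f := fun w => Real.cos (Real.pi / n) * ‖branch n p w‖) (g := fun w => (branch n p w).re)
    (fun v hv => (cos_mul_norm_branch_lt hn hp hq (by simpa using hv)).le)
    (continuousOn_const.mul hc.norm) (Complex.continuous_re.comp_continuousOn hc) ?_
  rw [closure_ball _ hr.ne']
  simpa using hw
end

/-! ### The exponential `e` -/

theorem e_add (a b : ℝ) : e (a + b) = e a * e b := by
  unfold e; rw [← Complex.exp_add]; push_cast; ring_nf

theorem e_neg (a : ℝ) : e (-a) = (e a)⁻¹ := by
  unfold e; rw [← Complex.exp_neg]; push_cast; ring_nf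

theorem e_ne_zero (a : ℝ) : e a ≠ 0 := Complex.exp_ne_zero _

theorem e_intCast (m : ℤ) : e m = 1 := by
  unfold e
  rw [Complex.exp_eq_one_iff]
  exact ⟨m, by push_cast; ring⟩

theorem norm_e (a : ℝ) : ‖e a‖ = 1 := by
  unfold e
  rw [show 2 * Real.pi * Complex.I * a = ((2 * Real.pi * a : ℝ) : ℂ) * Complex.I by
    push_cast; ring, Complex.norm_exp_ofReal_mul_I]

theorem e_eq_e_iff {a b : ℝ} : e a = e b ↔ ∃ m : ℤ, a = b + m := by
  unfold e
  rw [Complex.exp_eq_exp_iff_exists_int]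
  have h2 : 2 * (Real.pi : ℂ) * Complex.I ≠ 0 := Complex.two_pi_I_ne_zero
  refine exists_congr fun m => ⟨fun h => ?_, fun h => ?_⟩
  · have : (a : ℂ) = b + m := mul_left_cancel₀ h2 (by rw [h]; ring)
    exact_mod_cast this
  · rw [h]; push_cast; ring

theorem e_div_eq_of_modEq {n : ℕ} (hn : 0 < n) {a b : ℤ} (h : a ≡ b [ZMOD n]) :
    e (a / n) = e (b / n) := by
  have hn' : (n : ℝ) ≠ 0 := Nat.cast_ne_zero.mpr hn.ne'
  obtain ⟨c, hc⟩ := h.dvd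
  refine e_eq_e_iff.mpr ⟨-c, ?_⟩
  have hc' : (b : ℝ) - a = n * c := by exact_mod_cast hc
  push_cast
  field_simp
  linarith
theorem e_pow (a : ℝ) (m : ℕ) : e a ^ m = e (m * a) := by
  unfold e; rw [← Complex.exp_nat_mul]; push_cast; ring_nf

theorem e_half : e (1 / 2) = -1 := by
  unfold e
  rw [← Complex.exp_pi_mul_I]; congr 1; push_cast; ring

theorem norm_mul_e_arg (u : ℂ) : (‖u‖ : ℂ) * e (u.arg / (2 * Real.pi)) = u := by
  conv_rhs => rw [← Complex.norm_mul_exp_arg_mul_I u]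
  unfold e
  have : (Real.pi : ℂ) ≠ 0 := by exact_mod_cast Real.pi_ne_zero
  congr 2
  push_cast
  field_simp

/-! ### Coincidences between rotated values of the branch -/

section
variable {n p q : ℕ} (hn : n = p + q) (hp : 0 < p) (hq : 1 < q)
include hn hp hq

/-- A value on the edge of the sector has `φ^n = -p/q` and `‖φ‖^p = (1 + p/q)/ρ`, so that
`w = (φ^n - 1)/φ^p` is determined by the edge. -/
theorem eq_radius_mul_e_of_arg {w : ℂ} (hw : ‖w‖ ≤ radius n p q) {σ : ℝ} (hσ : σ = 1 ∨ σ = -1)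
    (harg : (branch n p w).arg = σ * (Real.pi / n)) :
    w = radius n p q * e (σ * (q / (2 * n))) := by
  have hn' : (n : ℝ) ≠ 0 := Nat.cast_ne_zero.mpr (by omega)
  have hnq : (n : ℝ) = p + q := by rw [hn]; push_cast; rfl
  have hpi := Real.pi_pos
  have habs : |(branch n p w).arg| = Real.pi / n := by
    rw [harg, abs_mul, abs_of_nonneg (show 0 ≤ Real.pi / (n : ℝ) by positivity)]
    rcases hσ with rfl | rfl <;> simp
  have hneg := pow_eq_neg_of_arg (by omega) habs
  obtain ⟨-, hs⟩ := norm_eq_of_branch_pow_eq_neg hn hp hq hw hneg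
  have hx0 : 0 < ‖branch n p w‖ := norm_pos_iff.mpr (branch_ne_zero hn hp hq hw)
  have hr := radius_mul_pow_eq hn hp hq hx0 hs
  have hpolar : (‖branch n p w‖ : ℂ) * e (σ / (2 * n)) = branch n p w := by
    conv_rhs => rw [← norm_mul_e_arg (branch n p w)]
    rw [harg]; congr 2; field_simp
  have htri := branch_trinomial hn hp hq hw
  rw [hneg] at htri
  have hpp : branch n p w ^ p = (‖branch n p w‖ : ℂ) ^ p * e (p * (σ / (2 * n))) := by
    conv_lhs => rw [← hpolar]
    rw [mul_pow, e_pow]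
  have hhalf : e (p * (σ / (2 * n))) * e (σ * (q / (2 * n))) = -1 := by
    rw [← e_add, show p * (σ / (2 * n)) + σ * (q / (2 * n)) = σ * (1 / 2) by
      field_simp; rw [hnq]]
    rcases hσ with rfl | rfl
    · rw [one_mul, e_half]
    · rw [neg_one_mul, e_neg, e_half]; norm_num
  have hrC : (radius n p q : ℂ) * (‖branch n p w‖ : ℂ) ^ p = 1 + (‖branch n p w‖ : ℂ) ^ n := by
    exact_mod_cast hr
  rw [hpp] at htri
  have hxC : (‖branch n p w‖ : ℂ) ^ p ≠ 0 := pow_ne_zero _ (by exact_mod_cast hx0.ne')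
  refine mul_right_cancel₀ (mul_ne_zero hxC (e_ne_zero (p * (σ / (2 * n))))) ?_
  linear_combination -htri + hrC - (radius n p q : ℂ) * (‖branch n p w‖ : ℂ) ^ p * hhalf

/-- Both arguments are at most `π/n` in absolute value and differ by a nonzero multiple of `2π/n`,
so they are `π/n` and `-π/n`. -/
theorem branch_eq_e_mul_branch {w w' : ℂ} (hw : ‖w‖ ≤ radius n p q) (hw' : ‖w'‖ ≤ radius n p q)
    {M : ℤ} (hM : ¬ (n : ℤ) ∣ M) (h : branch n p w = e (M / n) * branch n p w') :
    (M ≡ 1 [ZMOD n] ∧ w = radius n p q * e (q / (2 * n)) ∧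
      w' = radius n p q * e (-(q / (2 * n)))) ∨
    (M ≡ -1 [ZMOD n] ∧ w = radius n p q * e (-(q / (2 * n))) ∧
      w' = radius n p q * e (q / (2 * n))) := by
  have hn' : (0 : ℝ) < n := Nat.cast_pos.mpr (by omega)
  have hpi := Real.pi_pos
  set u := branch n p w with hu
  set u' := branch n p w' with hu'
  have hu0 : u ≠ 0 := branch_ne_zero hn hp hq hw
  have ha := abs_le.mp (abs_arg_branch_le hn hp hq hw)
  have ha' := abs_le.mp (abs_arg_branch_le hn hp hq hw')
  rw [← hu] at ha
  rw [← hu'] at ha'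
  have hnorm : ‖u‖ = ‖u'‖ := by rw [h, norm_mul, norm_e, one_mul]
  have he : e (u.arg / (2 * Real.pi)) = e (M / n + u'.arg / (2 * Real.pi)) := by
    refine mul_left_cancel₀ (show (‖u‖ : ℂ) ≠ 0 by exact_mod_cast norm_ne_zero_iff.mpr hu0) ?_
    rw [norm_mul_e_arg, e_add, hnorm, mul_left_comm, norm_mul_e_arg, h]
  obtain ⟨l, hl⟩ := e_eq_e_iff.mp he
  have hdiff : u.arg - u'.arg = 2 * ((M + n * l : ℤ) : ℝ) * (Real.pi / n) := by
    push_cast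
    field_simp at hl ⊢
    linarith
  have hc0 : 0 < Real.pi / n := by positivity
  generalize hc : Real.pi / n = c at ha ha' hdiff hc0
  have hK0 : M + n * l ≠ 0 := by
    intro h0
    exact hM ⟨-l, by linarith⟩
  have hK1 : M + n * l ≤ 1 := by
    by_contra! hlt
    have : (2 : ℝ) ≤ ((M + n * l : ℤ) : ℝ) := by exact_mod_cast hlt
    nlinarith
  have hK2 : -1 ≤ M + n * l := by
    by_contra! hlt
    have : ((M + n * l : ℤ) : ℝ) ≤ -2 := by exact_mod_cast (by omega : M + n * l ≤ -2)
    nlinarith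
  have hK : M + n * l = 1 ∨ M + n * l = -1 := by omega
  have hmod : M + n * l ≡ M [ZMOD n] := by simp [Int.ModEq]
  rcases hK with hK | hK
  · rw [hK] at hdiff hmod
    push_cast at hdiff
    refine Or.inl ⟨hmod.symm, ?_, ?_⟩
    · simpa using eq_radius_mul_e_of_arg hn hp hq hw (Or.inl rfl) (by rw [← hu, hc]; linarith)
    · simpa using eq_radius_mul_e_of_arg hn hp hq hw' (Or.inr rfl) (by rw [← hu', hc]; linarith)
  · rw [hK] at hdiff hmod
    push_cast at hdiff
    refine Or.inr ⟨hmod.symm, ?_, ?_⟩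
    · simpa using eq_radius_mul_e_of_arg hn hp hq hw (Or.inr rfl) (by rw [← hu, hc]; linarith)
    · simpa using eq_radius_mul_e_of_arg hn hp hq hw' (Or.inl rfl) (by rw [← hu', hc]; linarith)
end

open Polynomial in
theorem not_injOn_roots_of_double_root {P : ℂ[X]} {n : ℕ} (hP : P ≠ 0) (hdeg : P.natDegree ≤ n)
    {y : ℕ → ℂ} (hy : ∀ s < n, P.eval (y s) = 0) {a : ℂ} (ha : P.eval a = 0)
    (ha' : P.derivative.eval a = 0) : ¬ Set.InjOn y (Finset.range n : Finset ℕ) := by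
  classical
  intro hinj
  have hsub : (Finset.range n).image y ⊆ P.roots.toFinset := by
    intro z hz
    obtain ⟨s, hs, rfl⟩ := Finset.mem_image.mp hz
    rw [Multiset.mem_toFinset, mem_roots hP]
    exact hy s (Finset.mem_range.mp hs)
  have hcard := Finset.card_le_card hsub
  rw [Finset.card_image_of_injOn hinj, Finset.card_range] at hcard
  have hnodup : P.roots.Nodup := by
    rw [← Multiset.toFinset_card_eq_card_iff_nodup]
    exact le_antisymm (Multiset.toFinset_card_le _) ((P.card_roots'.trans hdeg).trans hcard)
  have h1 := (one_lt_rootMultiplicity_iff_isRoot hP).mpr ⟨ha, ha'⟩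
  rw [← count_roots] at h1
  exact absurd (Multiset.nodup_iff_count_le_one.mp hnodup a) (by omega)

section
variable {n p q : ℕ} (hn : n = p + q) (hp : 0 < p) (hq : 1 < q)
include hn hp hq

open Polynomial in
/-- The two edge values coincide. Otherwise the `n` numbers `y s = e(s/n) φ(w s)` would be pairwise
distinct roots of `X^n - W X^p - 1`, where `W = ρ e(q/(2n))`, which has degree `n` and the double
root `a = (p/q)^{1/n} e(1/(2n))`. -/
theorem branch_critical :
    branch n p (radius n p q * e (q / (2 * n))) =
      e (1 / n) * branch n p (radius n p q * e (-(q / (2 * n)))) := by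
  have hn' : (0 : ℝ) < n := Nat.cast_pos.mpr (by omega)
  have hp' : (0 : ℝ) < p := Nat.cast_pos.mpr hp
  have hq' : (0 : ℝ) < q := Nat.cast_pos.mpr (by omega)
  have hnq : (n : ℝ) = p + q := by rw [hn]; push_cast; rfl
  have hr := radius_pos (n := n) (by omega) hp (by omega : 0 < q)
  set W : ℂ := radius n p q * e (q / (2 * n)) with hW
  set W' : ℂ := radius n p q * e (-(q / (2 * n))) with hW'
  let w : ℕ → ℂ := fun s => e (-(q * s / n)) * W
  let y : ℕ → ℂ := fun s => e (s / n) * branch n p (w s)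
  have hwn : ∀ s, ‖w s‖ ≤ radius n p q := by
    intro s
    simp only [w, hW]
    rw [norm_mul, norm_mul, norm_e, norm_e, Complex.norm_real, Real.norm_of_nonneg hr.le,
      one_mul, mul_one]
  have hen : ∀ s : ℕ, e (s / n) ^ n = 1 := by
    intro s
    rw [e_pow, mul_div_cancel₀ _ hn'.ne']
    exact_mod_cast e_intCast s
  let P : ℂ[X] := X ^ n - C W * X ^ p - 1
  have hPe : ∀ z, P.eval z = z ^ n - W * z ^ p - 1 := by intro z; simp [P]
  have hPd : ∀ z, P.derivative.eval z = n * z ^ (n - 1) - W * (p * z ^ (p - 1)) := by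
    intro z; simp [P, derivative_X_pow]
  have hdeg : P.natDegree ≤ n := by
    have : p ≤ n := by omega
    simp only [P]
    compute_degree!
  have hP0 : P ≠ 0 := by
    intro h0
    have := hPe 0
    rw [h0, zero_pow (by omega), zero_pow (by omega)] at this
    simp at this
  have hy : ∀ s < n, P.eval (y s) = 0 := by
    intro s _
    have htri := branch_trinomial hn hp hq (hwn s)
    have hsq : e (s / n) ^ p * e (q * s / n) = 1 := by
      rw [← hen s, hn, pow_add, e_pow _ q, ← hn, mul_div_assoc]
    have hqq : e (-(q * s / n)) * e (q * s / n) = 1 := by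
      rw [e_neg, inv_mul_cancel₀ (e_ne_zero _)]
    have hk : W * e (s / n) ^ p = w s := by
      simp only [w]
      linear_combination -W * e (s / n) ^ p * hqq + W * e (-(q * s / n)) * hsq
    rw [hPe]
    simp only [y]
    rw [mul_pow, mul_pow, hen, htri, ← hk]
    ring
  let x : ℝ := ((p : ℝ) / q) ^ (1 / (n : ℝ))
  have hx0 : 0 < x := Real.rpow_pos_of_pos (by positivity) _
  have hxn : x ^ n = p / q := by
    simp only [x]
    rw [← Real.rpow_natCast, ← Real.rpow_mul (by positivity), one_div_mul_cancel hn'.ne',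
      Real.rpow_one]
  have hxr := radius_mul_pow_eq hn hp hq hx0 hxn
  let a : ℂ := x * e (1 / (2 * n))
  have ha0 : a ≠ 0 := mul_ne_zero (by exact_mod_cast hx0.ne') (e_ne_zero _)
  have han : a ^ n = -(p / q : ℝ) := by
    simp only [a]
    rw [mul_pow, e_pow, show (n : ℝ) * (1 / (2 * n)) = 1 / 2 by field_simp, e_half, ← hxn]
    push_cast; ring
  have hap : W * a ^ p = -(1 + p / q : ℝ) := by
    have h1 : e (q / (2 * n)) * e (p * (1 / (2 * n))) = -1 := by
      rw [← e_add, ← e_half]; congr 1; field_simp; rw [hnq]; ring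
    rw [← hxn, ← hxr]
    simp only [a, hW]
    rw [mul_pow, e_pow]
    push_cast
    linear_combination (radius n p q : ℂ) * (x : ℂ) ^ p * h1
  have haP : P.eval a = 0 := by
    rw [hPe, han, hap]; push_cast; ring
  have haP' : P.derivative.eval a = 0 := by
    rw [hPd]
    refine (mul_eq_zero.mp (?_ : _ * a = 0)).resolve_right ha0
    have e1 : a ^ (n - 1) * a = a ^ n := by rw [← pow_succ, Nat.sub_add_cancel (by omega)]
    have e2 : a ^ (p - 1) * a = a ^ p := by rw [← pow_succ, Nat.sub_add_cancel (by omega)]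
    have e3 : ((n : ℝ) : ℂ) * (p / q : ℝ) = (p : ℝ) * (1 + p / q : ℝ) := by
      have : (n : ℝ) * (p / q) = p * (1 + p / q) := by rw [hnq]; field_simp; ring
      exact_mod_cast congrArg Complex.ofReal this
    calc _ = n * (a ^ (n - 1) * a) - p * (W * (a ^ (p - 1) * a)) := by ring
      _ = 0 := by
        rw [e1, e2, han, hap]
        push_cast at e3 ⊢
        linear_combination -e3
  -- any coincidence `y s = y s'` would be the claimed one, possibly with sides exchanged
  by_contra hne
  refine not_injOn_roots_of_double_root hP0 hdeg hy haP haP' ?_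
  intro s hs s' hs' hss
  by_contra hne'
  have hs : s < n := by simpa using hs
  have hs' : s' < n := by simpa using hs'
  have hM : ¬ (n : ℤ) ∣ ((s' : ℤ) - s) := by
    intro hd
    have := Int.eq_zero_of_abs_lt_dvd hd (by rw [abs_lt]; constructor <;> omega)
    omega
  have hbr : branch n p (w s) = e (((s' - s : ℤ) : ℝ) / n) * branch n p (w s') := by
    refine mul_left_cancel₀ (e_ne_zero (s / n)) ?_
    rw [← mul_assoc, ← e_add, ← add_div]
    push_cast
    rw [add_sub_cancel]
    exact hss
  have hcong : ∀ m : ℤ, m ≡ 1 [ZMOD n] → e (m / n) = e (1 / n) := fun m hm => by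
    simpa using e_div_eq_of_modEq (by omega) hm
  rcases branch_eq_e_mul_branch hn hp hq (hwn s) (hwn s') hM hbr with ⟨h1, h2, h3⟩ | ⟨h1, h2, h3⟩
  · rw [h2, h3, hcong _ h1] at hbr
    exact hne hbr
  · rw [h2, h3] at hbr
    have h4 : -((s' : ℤ) - s) ≡ 1 [ZMOD n] := by simpa using h1.neg
    apply hne
    rw [← hcong _ h4, hW', hbr, ← mul_assoc, ← e_add]
    push_cast
    rw [neg_div, neg_add_cancel, show e 0 = 1 by exact_mod_cast e_intCast 0, one_mul]
end

/-! ### The Puiseux roots in terms of the branch -/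

/-- The point `w = e(-q/(2n)) ξ^{-N}` at which `branch` is evaluated, as a function of
`ξ = X^{1/n}`. -/
noncomputable def branchArg (n q N : ℕ) (ξ : ℂ) : ℂ := e (-(q / (2 * n))) * (ξ ^ N)⁻¹

theorem seriesTerm_eq {n p q : ℕ} (hn : n = p + q) (hn0 : n ≠ 0) (r N : ℕ) {ξ : ℂ} (hξ : ξ ≠ 0)
    (k : ℕ) : seriesTerm n p q r N ξ k =
      n * ξ ^ r * ((hagen ((p : ℂ) / n) k).eval (1 / (n : ℂ)) * branchArg n q N ξ ^ k) := by
  have h1 : ξ ^ ((r : ℤ) - (N : ℤ) * (k : ℤ)) = ξ ^ r * (ξ ^ N)⁻¹ ^ k := by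
    rw [zpow_sub₀ hξ, zpow_natCast, zpow_mul, zpow_natCast, zpow_natCast, inv_pow, div_eq_mul_inv]
  have h2 : e (-((q : ℝ) * k) / (2 * n)) = e (-(q / (2 * n))) ^ k := by
    rw [e_pow]; congr 1; ring
  rw [seriesTerm, Gamma_quotient_eq_hagen hn hn0, eval_hagen_ofReal, h1, h2, branchArg, mul_pow]
  push_cast
  ring

theorem Y₀_eq {n p q : ℕ} (hn : n = p + q) (hn0 : n ≠ 0) (r N : ℕ) {ξ : ℂ} (hξ : ξ ≠ 0) :
    Y₀ n p q r N ξ = e (1 / (2 * n)) * ξ ^ r * branch n p (branchArg n q N ξ) := by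
  have hn' : (n : ℂ) ≠ 0 := Nat.cast_ne_zero.mpr hn0
  rw [Y₀, funext (seriesTerm_eq hn hn0 r N hξ), tsum_mul_left, ← branch]
  field_simp

theorem f_Y₀ {n p q g r N : ℕ} (hn : n = p + q) (hp : 0 < p) (hq : 1 < q)
    (hN : (N : ℤ) = (q : ℤ) * r - (n : ℤ) * g) {ξ : ℂ} (hξ : ξ ≠ 0)
    (hw : ‖branchArg n q N ξ‖ ≤ radius n p q) : f n p g r (ξ ^ n) (Y₀ n p q r N ξ) = 0 := by
  have hn' : (n : ℝ) ≠ 0 := Nat.cast_ne_zero.mpr (by omega)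
  have hnq : (n : ℝ) = p + q := by rw [hn]; push_cast; rfl
  have htri := branch_trinomial hn hp hq hw
  have h1 : e (1 / (2 * n)) ^ n = -1 := by
    rw [e_pow, show (n : ℝ) * (1 / (2 * n)) = 1 / 2 by field_simp, e_half]
  have h2 : e (1 / (2 * n)) ^ p = -e (-(q / (2 * n))) := by
    rw [e_pow, neg_eq_neg_one_mul, ← e_half, ← e_add]
    congr 1
    field_simp
    rw [hnq]; ring
  have h3 : (ξ ^ n) ^ g * (ξ ^ r) ^ p = (ξ ^ r) ^ n * (ξ ^ N)⁻¹ := by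
    rw [eq_mul_inv_iff_mul_eq₀ (pow_ne_zero _ hξ), ← pow_mul, ← pow_mul, ← pow_mul, ← pow_add,
      ← pow_add]
    congr 1
    zify
    rw [hN, hn]; push_cast; ring
  rw [f, Y₀_eq hn (by omega) r N hξ, mul_pow, mul_pow, mul_pow, mul_pow, h1, h2, htri]
  simp only [branchArg]
  set B := branch n p (e (-(q / (2 * n))) * (ξ ^ N)⁻¹)
  linear_combination e (-(q / (2 * n))) * B ^ p * h3

section
variable {n p q N : ℕ} (hn : 0 < n) (hp : 0 < p) (hq : 0 < q)
include hn hp hq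

theorem ωRoot_ne_zero (m : ℤ) : ωRoot n p q N m ≠ 0 :=
  mul_ne_zero (by exact_mod_cast (Real.rpow_pos_of_pos (R_pos hn hp hq) _).ne') (e_ne_zero _)

theorem branchArg_ωRoot (hN : 0 < N) (t : ℕ) (m : ℤ) :
    branchArg n q N (e ((t : ℝ) / n) * ωRoot n p q N m) =
      radius n p q * e (-(q / (2 * n)) - (N * t + m : ℤ) / n) := by
  have hn' : (n : ℝ) ≠ 0 := Nat.cast_ne_zero.mpr hn.ne'
  have hN' : (N : ℝ) ≠ 0 := Nat.cast_ne_zero.mpr hN.ne'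
  have h1 : (R n p q ^ (1 / ((n : ℝ) * N))) ^ N = (radius n p q)⁻¹ := by
    rw [radius, ← Real.rpow_natCast, ← Real.rpow_mul (R_pos hn hp hq).le,
      ← Real.rpow_neg (R_pos hn hp hq).le]
    congr 1
    field_simp
  rw [branchArg, ωRoot, mul_pow, mul_pow, e_pow, e_pow, ← Complex.ofReal_pow, h1, mul_inv, mul_inv,
    ← e_neg, ← e_neg, Complex.ofReal_inv, inv_inv, mul_left_comm (e _) (radius n p q : ℂ),
    ← e_add, mul_left_comm, ← e_add]
  congr 2
  push_cast
  field_simp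
  ring

theorem radius_mul_e_eq_iff (x y : ℝ) : (radius n p q : ℂ) * e x = radius n p q * e y ↔
    ∃ c : ℤ, x = y + c := by
  rw [mul_right_inj' (by exact_mod_cast (radius_pos hn hp hq).ne'), e_eq_e_iff]
end

theorem neg_sub_div_eq_neg_iff {n : ℕ} (hn : 0 < n) (x : ℝ) (M : ℤ) :
    (∃ c : ℤ, -x - (M : ℝ) / n = -x + c) ↔ (n : ℤ) ∣ M := by
  have hn' : (n : ℝ) ≠ 0 := Nat.cast_ne_zero.mpr hn.ne'
  constructor
  · rintro ⟨c, hc⟩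
    refine ⟨-c, ?_⟩
    field_simp at hc
    have : (M : ℝ) = n * -c := by linarith
    exact_mod_cast this
  · rintro ⟨c, rfl⟩
    exact ⟨-c, by push_cast; field_simp; ring⟩

theorem neg_sub_div_eq_iff {n : ℕ} (hn : 0 < n) (q : ℕ) (M : ℤ) :
    (∃ c : ℤ, -((q : ℝ) / (2 * n)) - (M : ℝ) / n = q / (2 * n) + c) ↔ (n : ℤ) ∣ M + q := by
  have hn' : (n : ℝ) ≠ 0 := Nat.cast_ne_zero.mpr hn.ne'
  rw [← neg_sub_div_eq_neg_iff hn (-(q / (2 * n)))]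
  refine exists_congr fun c => ?_
  push_cast
  constructor <;> intro h <;> field_simp at h ⊢ <;> linarith

theorem Y_eq_iff {n p q r N : ℕ} (hn : n = p + q) (hp : 0 < p) (hq : 1 < q) (hNpos : 0 < N) (m : ℤ)
    (t t' : ℕ) :
    Y n p q r N t (ωRoot n p q N m) = Y n p q r N t' (ωRoot n p q N m) ↔
    branch n p (radius n p q * e (-(q / (2 * n)) - (N * t + m : ℤ) / n)) =
      e ((r * t' - r * t : ℤ) / n) *
        branch n p (radius n p q * e (-(q / (2 * n)) - (N * t' + m : ℤ) / n)) := by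
  have hn0 : 0 < n := by omega
  have hq0 : 0 < q := by omega
  have h0 : ωRoot n p q N m ≠ 0 := ωRoot_ne_zero hn0 hp hq0 m
  have hY : ∀ s : ℕ, Y n p q r N s (ωRoot n p q N m) =
      e (1 / (2 * n)) * ωRoot n p q N m ^ r * (e (r * s / n) *
        branch n p (radius n p q * e (-(q / (2 * n)) - (N * s + m : ℤ) / n))) := by
    intro s
    rw [Y, Y₀_eq hn hn0.ne' r N (mul_ne_zero (e_ne_zero _) h0), branchArg_ωRoot hn0 hp hq0 hNpos,
      mul_pow, e_pow, mul_div_assoc]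
    ring
  have he : e (r * t' / n) = e (r * t / n) * e ((r * t' - r * t : ℤ) / n) := by
    rw [← e_add]; congr 1; push_cast; ring
  rw [hY, hY, mul_right_inj' (mul_ne_zero (e_ne_zero _) (pow_ne_zero _ h0)), he, mul_assoc,
    mul_right_inj' (e_ne_zero _)]

end Trinomial

theorem mainTheorem5 (n p q g r N : ℕ)
    (hn : n = p + q) (hq : 1 < q) (hnp : Nat.Coprime n p)
    (hN : (N : ℤ) = (q : ℤ) * r - (n : ℤ) * g) (hNpos : 0 < N)
    (hpr : Int.gcd (p : ℤ) ((r : ℤ) - g) = 1) (hnr : Nat.Coprime n r)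
    (j ℓ ℓbar : ℤ) (hℓbar : ℓbar = p * (j + 1) + ℓ) :
    (∀ t : ℕ, t < n →
      Summable (Trinomial.seriesTerm n p q r N
        (Trinomial.e ((t : ℝ) / n) * Trinomial.ωRoot n p q N ℓbar)) ∧
      Trinomial.f n p g r (Trinomial.ω n p q N ℓbar)
        (Trinomial.Y n p q r N t (Trinomial.ωRoot n p q N ℓbar)) = 0) ∧
    (∀ t t' : ℕ, t < n → t' < n → t ≠ t' →
      (Trinomial.Y n p q r N t (Trinomial.ωRoot n p q N ℓbar) =
          Trinomial.Y n p q r N t' (Trinomial.ωRoot n p q N ℓbar) ↔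
        ((r * t' ≡ r * t + 1 [ZMOD n] ∧ p * r * t ≡ p * j + ℓ [ZMOD n]) ∨
          (r * t ≡ r * t' + 1 [ZMOD n] ∧ p * r * t' ≡ p * j + ℓ [ZMOD n])))) ∧
    (∀ t t' : ℕ, t < n → t' < n →
      ((r * t' ≡ r * t + 1 [ZMOD n] ∧ p * r * t ≡ p * j + ℓ [ZMOD n]) ↔
        (r * t' ≡ r * t + 1 [ZMOD n] ∧ ℓbar ≡ p * r * t' [ZMOD n]))) := by
  have hp : 0 < p := by
    rcases Nat.eq_zero_or_pos p with rfl | h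
    · rw [Nat.coprime_zero_right] at hnp
      omega
    · exact h
  have hn0 : 0 < n := by omega
  have hq0 : 0 < q := by omega
  have hr := Trinomial.radius_pos hn0 hp hq0
  have hnorm : ∀ x : ℝ, ‖(Trinomial.radius n p q : ℂ) * Trinomial.e x‖ ≤
      Trinomial.radius n p q := fun x => by
    rw [norm_mul, Trinomial.norm_e, mul_one, Complex.norm_real, Real.norm_of_nonneg hr.le]
  -- `N ≡ qr ≡ -pr` modulo `n`, and so `N s + ℓbar + q ≡ pj + ℓ - p r s`
  have hplus : ∀ s : ℕ, (n : ℤ) ∣ (N * s + ℓbar) + q ↔ p * r * s ≡ p * j + ℓ [ZMOD n] := by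
    intro s
    rw [Int.modEq_iff_dvd, hN, hℓbar]
    refine dvd_iff_dvd_of_dvd_sub ⟨r * s - g * s + 1, ?_⟩
    rw [hn]; push_cast; ring
  refine ⟨fun t _ => ?_, fun t t' ht ht' hne => ?_, fun t t' _ _ => ?_⟩
  · have hξ : Trinomial.e ((t : ℝ) / n) * Trinomial.ωRoot n p q N ℓbar ≠ 0 :=
      mul_ne_zero (Trinomial.e_ne_zero _) (Trinomial.ωRoot_ne_zero hn0 hp hq0 _)
    have hw : ‖Trinomial.branchArg n q N
        (Trinomial.e ((t : ℝ) / n) * Trinomial.ωRoot n p q N ℓbar)‖ ≤ Trinomial.radius n p q := by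
      rw [Trinomial.branchArg_ωRoot hn0 hp hq0 hNpos]
      exact hnorm _
    constructor
    · rw [funext (Trinomial.seriesTerm_eq hn hn0.ne' r N hξ)]
      exact (Trinomial.summable_norm_branch_term hn hp hq hw).of_norm.mul_left _
    · have hX : (Trinomial.e ((t : ℝ) / n) * Trinomial.ωRoot n p q N ℓbar) ^ n =
          Trinomial.ω n p q N ℓbar := by
        rw [mul_pow, Trinomial.ωRoot_pow n p q N hn0.ne', Trinomial.e_pow,
          mul_div_cancel₀ _ (Nat.cast_ne_zero.mpr hn0.ne'),
          show Trinomial.e (t : ℝ) = 1 by exact_mod_cast Trinomial.e_intCast t, one_mul]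
      rw [← hX]
      exact Trinomial.f_Y₀ hn hp hq hN hξ hw
  · have hcop : IsCoprime (n : ℤ) (r : ℤ) := Nat.isCoprime_iff_coprime.mpr hnr
    have hM : ¬ (n : ℤ) ∣ (r * t' - r * t : ℤ) := by
      intro hd
      rw [← mul_sub] at hd
      have := Int.eq_zero_of_abs_lt_dvd (hcop.dvd_of_dvd_mul_left hd)
        (by rw [abs_lt]; constructor <;> omega)
      omega
    -- `N s' + ℓbar ≡ ℓbar - p r s' ≡ pj + ℓ - p r s`
    have hminus : ∀ s s' : ℕ, (r * s' ≡ r * s + 1 [ZMOD n]) →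
        ((n : ℤ) ∣ (N * s' + ℓbar) ↔ p * r * s ≡ p * j + ℓ [ZMOD n]) := by
      intro s s' hs
      obtain ⟨c, hc⟩ := hs.dvd
      rw [Int.modEq_iff_dvd, hN, hℓbar]
      refine dvd_iff_dvd_of_dvd_sub ⟨r * s' - g * s' + p * c, ?_⟩
      rw [hn] at hc ⊢
      push_cast at hc ⊢
      linear_combination (p : ℤ) * hc
    rw [Trinomial.Y_eq_iff hn hp hq hNpos]
    constructor
    · intro h
      rcases Trinomial.branch_eq_e_mul_branch hn hp hq (hnorm _) (hnorm _) hM h with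
        ⟨h1, h2, h3⟩ | ⟨h1, h2, h3⟩
      · rw [Trinomial.radius_mul_e_eq_iff hn0 hp hq0, Trinomial.neg_sub_div_eq_iff hn0] at h2
        exact Or.inl ⟨by simpa [add_comm] using h1.add_right (r * t), (hplus t).mp h2⟩
      · rw [Trinomial.radius_mul_e_eq_iff hn0 hp hq0, Trinomial.neg_sub_div_eq_iff hn0] at h3
        exact Or.inr ⟨by simpa [add_comm] using h1.neg.add_right (r * t'), (hplus t').mp h3⟩
    · have hW : ∀ s : ℕ, p * r * s ≡ p * j + ℓ [ZMOD n] →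
          (Trinomial.radius n p q : ℂ) *
            Trinomial.e (-(q / (2 * n)) - (N * s + ℓbar : ℤ) / n) =
          Trinomial.radius n p q * Trinomial.e (q / (2 * n)) := fun s hs => by
        rw [Trinomial.radius_mul_e_eq_iff hn0 hp hq0, Trinomial.neg_sub_div_eq_iff hn0]
        exact (hplus s).mpr hs
      have hW' : ∀ s s' : ℕ, (r * s' ≡ r * s + 1 [ZMOD n]) → p * r * s ≡ p * j + ℓ [ZMOD n] →
          (Trinomial.radius n p q : ℂ) *
            Trinomial.e (-(q / (2 * n)) - (N * s' + ℓbar : ℤ) / n) =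
          Trinomial.radius n p q * Trinomial.e (-(q / (2 * n))) := fun s s' h hs => by
        rw [Trinomial.radius_mul_e_eq_iff hn0 hp hq0, Trinomial.neg_sub_div_eq_neg_iff hn0]
        exact (hminus s s' h).mpr hs
      have hone : ∀ s s' : ℕ, (r * s' ≡ r * s + 1 [ZMOD n]) →
          Trinomial.e ((r * s' - r * s : ℤ) / n) = Trinomial.e (1 / n) := fun s s' h => by
        have := Trinomial.e_div_eq_of_modEq hn0 (h.sub_right (r * s))
        rw [this]
        simp
      -- in the second case the roles of `t` and `t'` are exchanged in `branch_critical`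
      rintro (⟨h1, h2⟩ | ⟨h1, h2⟩)
      · rw [hW t h2, hW' t t' h1 h2, hone t t' h1]
        exact Trinomial.branch_critical hn hp hq
      · rw [hW t' h2, hW' t' t h1 h2, Trinomial.branch_critical hn hp hq, ← mul_assoc,
          ← hone t' t h1, ← Trinomial.e_add, ← add_div, ← Int.cast_add, sub_add_sub_cancel,
          sub_self]
        simp [Trinomial.e]
  · refine and_congr_right fun h => ?_
    obtain ⟨c, hc⟩ := h.dvd
    rw [Int.modEq_iff_dvd, Int.modEq_iff_dvd, ← dvd_neg (b := (p : ℤ) * r * t' - ℓbar), hℓbar]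
    refine dvd_iff_dvd_of_dvd_sub ⟨-(p * c), ?_⟩
    linear_combination -(p : ℤ) * hc
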